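/- Let $n\ge 1$, $m\ge 0$, $r\ge 0$, $N=n+m\ge 3$, and let $\Delta=(v_{n+1},\dots,v_N)$ be an $m$-tuple of nonzero vectors in $\mathbb{Z}^r$ with $\sum_k v_k=0$; put $v_1=\dots=v_n=0$. Let $\mathcal{M}_{0,N,\mathrm{trop}}$ be the set of isomorphism classes of rational tropical curves (metric trees, all vertices of valence at least 3) with exactly $N$ ends $x_1,\dots,x_N$, all of them labeled. Let $\mathcal{M}^{\mathrm{lab}}_{0,n,\mathrm{trop}}(\mathbb{R}^r,\Delta)$ be the set of isomorphism classes of such curves $(\Gamma,x_1,\dots,x_N)$ together with a continuous map $h:\Gamma\to\mathbb{R}^r$ that is affine with integral direction on every edge, satisfies the balancing condition at every vertex, and has direction $v_k$ on the end $x_k$ for all $k$ (so $x_1,\dots,x_n$ are contracted). For $1\le i\le n$ let $\mathrm{ev}_i(\Gamma,x_1,\dots,x_N,h)=h(x_i)\in\mathbb{R}^r$. Let $Q_N=\mathbb{R}^{\binom N2}/\operatorname{im}\Phi_N$ with $\Phi_N(a)=(a_i+a_j)_{\{i,j\}}$, let $\varphi_N:\mathcal{M}_{0,N,\mathrm{trop}}\to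 Q_N$ send a curve to the class of the vector of distances between its ends, and let $\Lambda_N\subset Q_N$ be the lattice generated by the vectors $v_I$ ($1<|I|<N-1$), where $v_I$ is the image of the tree with a single bounded edge, of length one, separating the ends in $I$ from the others. Regard $\mathcal{M}_{0,N,\mathrm{trop}}$ as the fan in $Q_N$ whose cones are generated, for a curve $\Gamma$ and a set of bounded edges of $\Gamma$, by the vectors $v_I$ with $I$ the set of ends on one side of such an edge. Embed $\mathcal{M}^{\mathrm{lab}}_{0,n,\mathrm{trop}}(\mathbb{R}^r,\Delta)$ in $Q_N\times\mathbb{R}^r$ by $C=(\Gamma,x_1,\dots,x_N,h)\mapsto(\varphi_N(\Gamma,x_1,\dots,x_N),\mathrm{ev}_1(C))$, and give it the structure of the fan $\mathcal{M}_{0,N,\mathrm{trop}}\times\mathbb{R}^r$ with lattice $\Lambda_N\times\mathbb{Z}^r$. Then for every $1\le i\le n$ the formula $$ (a,b)\longmapsto b+\frac12\sum_{\substack{k=2\\ k\ne i}}^{N}\bigl(a_{\{1,k\}}-a_{\{i,k\}}\bigr)v_k $$ induces a linear map $F:Q_N\times\mathbb{R}^r\to\mathbb{R}^r$ with $F(\Lambda_N\times\mathbb{Z}^r)\subset\mathbb{Z}^r$,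 and $F(\varphi_N(\Gamma,x_1,\dots,x_N),\mathrm{ev}_1(C))=\mathrm{ev}_i(C)$ for every $C$ in $\mathcal{M}^{\mathrm{lab}}_{0,n,\mathrm{trop}}(\mathbb{R}^r,\Delta)$. Hence $\mathrm{ev}_i$ is a morphism of fans from $\mathcal{M}_{0,N,\mathrm{trop}}\times\mathbb{R}^r$ to $\mathbb{R}^r$ (with lattice $\mathbb{Z}^r$), i.e. a map between the supports induced by a linear map that respects the lattices. -/

import Mathlib

noncomputable section

namespace TropModuli

open Classical

/-! ## Fans and morphisms of fans -/

section Fans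

variable {V V' : Type*} [AddCommGroup V] [Module ℝ V] [AddCommGroup V'] [Module ℝ V']

/-- A (not necessarily strictly convex) rational polyhedral cone with respect to the lattice `Λ`:
a cone generated by finitely many lattice vectors. -/
def IsRationalCone (Λ : AddSubgroup V) (σ : PointedCone ℝ V) : Prop :=
  ∃ s : Set V, s.Finite ∧ s ⊆ Λ ∧ PointedCone.hull ℝ s = σ

/-- A fan in the real vector space `V` with lattice `Λ`: a finite set of rational polyhedral cones,
closed under passing to faces, such that any two of its cones intersect in a common face. -/
structure Fan (Λ : AddSubgroup V) where
  cones : Set (PointedCone ℝ V)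
  finite : cones.Finite
  isRationalCone : ∀ σ ∈ cones, IsRationalCone Λ σ
  face_mem : ∀ σ ∈ cones, ∀ τ : PointedCone ℝ V, τ.IsFaceOf σ → τ ∈ cones
  inf_isFaceOf : ∀ σ ∈ cones, ∀ τ ∈ cones,
    (σ ⊓ τ : PointedCone ℝ V).IsFaceOf σ ∧ (σ ⊓ τ : PointedCone ℝ V).IsFaceOf τ

/-- The support `|X|` of a fan: the union of its cones. -/
def Fan.support {Λ : AddSubgroup V} (X : Fan Λ) : Set V :=
  {x | ∃ σ ∈ X.cones, x ∈ σ}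

/-- A map `|X| → |Y|` is a morphism of fans if it is induced by a linear map that sends the
lattice of `X` into the lattice of `Y`. -/
def IsFanMorphism {Λ : AddSubgroup V} {Λ' : AddSubgroup V'} (X : Fan Λ) (Y : Fan Λ')
    (f : X.support → Y.support) : Prop :=
  ∃ F : V →ₗ[ℝ] V', (∀ x ∈ Λ, F x ∈ Λ') ∧ ∀ x : X.support, (f x : V') = F (x : V)

theorem IsRationalCone.prod {Λ : AddSubgroup V} {Λ' : AddSubgroup V'} {σ : PointedCone ℝ V}
    {τ : PointedCone ℝ V'} (hσ : IsRationalCone Λ σ) (hτ : IsRationalCone Λ' τ) :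
    IsRationalCone (Λ.prod Λ') (σ.prod τ) := by
  obtain ⟨s, hs, hsΛ, rfl⟩ := hσ
  obtain ⟨t, ht, htΛ, rfl⟩ := hτ
  refine ⟨LinearMap.inl _ V V' '' s ∪ LinearMap.inr _ V V' '' t,
    (hs.image _).union (ht.image _), ?_, LinearMap.span_inl_union_inr⟩
  rintro x (⟨y, hy, rfl⟩ | ⟨y, hy, rfl⟩)
  · exact ⟨hsΛ hy, Λ'.zero_mem⟩
  · exact ⟨Λ.zero_mem, htΛ hy⟩

/-- The product of two fans, whose cones are the products `σ × σ'`. -/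
def Fan.prod {Λ : AddSubgroup V} {Λ' : AddSubgroup V'} (X : Fan Λ) (Y : Fan Λ') :
    Fan (Λ.prod Λ') where
  cones := {ρ | ∃ σ ∈ X.cones, ∃ τ ∈ Y.cones, ρ = σ.prod τ}
  finite := by
    refine ((X.finite.prod Y.finite).image (fun p => p.1.prod p.2)).subset ?_
    rintro ρ ⟨σ, hσ, τ, hτ, rfl⟩
    exact ⟨(σ, τ), ⟨hσ, hτ⟩, rfl⟩
  isRationalCone := by
    rintro ρ ⟨σ, hσ, τ, hτ, rfl⟩
    exact (X.isRationalCone σ hσ).prod (Y.isRationalCone τ hτ)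
  face_mem := by
    rintro ρ ⟨σ, hσ, τ, hτ, rfl⟩ F hF
    refine ⟨_, X.face_mem σ hσ _ hF.fst, _, Y.face_mem τ hτ _ hF.snd, ?_⟩
    ext ⟨x, y⟩
    constructor
    · intro h
      exact ⟨⟨(x, y), h, rfl⟩, ⟨(x, y), h, rfl⟩⟩
    · rintro ⟨⟨⟨x', y'⟩, h1, h1'⟩, ⟨⟨x'', y''⟩, h2, h2'⟩⟩
      simp only [LinearMap.coe_restrictScalars, LinearMap.fst_apply, LinearMap.snd_apply]
        at h1' h2'
      subst h1' h2'
      have e1 := hF.le h1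
      have e2 := hF.le h2
      have a1 : ((x', (0 : V')) : V × V') ∈ F := by
        refine hF.mem_of_add_mem_left (y := (0, y')) ⟨e1.1, τ.zero_mem⟩ ⟨σ.zero_mem, e1.2⟩ ?_
        simpa using h1
      have a2 : (((0 : V), y'') : V × V') ∈ F := by
        refine hF.mem_of_add_mem_right (x := (x'', 0)) ⟨e2.1, τ.zero_mem⟩ ⟨σ.zero_mem, e2.2⟩ ?_
        simpa using h2
      simpa using F.add_mem a1 a2
  inf_isFaceOf := by
    rintro ρ ⟨σ, hσ, τ, hτ, rfl⟩ ρ' ⟨σ', hσ', τ', hτ', rfl⟩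
    have h1 := X.inf_isFaceOf σ hσ σ' hσ'
    have h2 := Y.inf_isFaceOf τ hτ τ' hτ'
    have e : (σ.prod τ ⊓ σ'.prod τ' : PointedCone ℝ (V × V'))
        = (σ ⊓ σ' : PointedCone ℝ V).prod (τ ⊓ τ' : PointedCone ℝ V') :=
      (Submodule.prod_inf_prod (p := σ) (p' := σ') (q₁ := τ) (q₁' := τ'))
    rw [e]
    exact ⟨h1.1.prod h2.1, h1.2.prod h2.2⟩

/-- The lattice `ℤ^r ⊆ ℝ^r`. -/
def stdLattice (r : ℕ) : AddSubgroup (Fin r → ℝ) :=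
  ((Int.castAddHom ℝ).compLeft (Fin r)).range

/-- The fan in `ℝ^r` (with lattice `ℤ^r`) whose only cone is `ℝ^r` itself. -/
def realFan (r : ℕ) : Fan (stdLattice r) where
  cones := {⊤}
  finite := Set.finite_singleton _
  isRationalCone := by
    rintro σ rfl
    refine ⟨Set.range (fun j : Fin r => (Pi.single j 1 : Fin r → ℝ)) ∪
      Set.range (fun j : Fin r => (-Pi.single j 1 : Fin r → ℝ)),
      (Set.finite_range _).union (Set.finite_range _), ?_, ?_⟩
    · have key : ∀ j : Fin r, (Pi.single j 1 : Fin r → ℝ) ∈ stdLattice r := by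
        intro j
        refine ⟨Pi.single j 1, ?_⟩
        ext k
        rcases eq_or_ne k j with rfl | h
        · simp
        · simp [h]
      rintro x (⟨j, rfl⟩ | ⟨j, rfl⟩)
      · exact key j
      · exact neg_mem (key j)
    · rw [eq_top_iff]
      intro x _
      have hx : x = ∑ j, x j • (Pi.single j 1 : Fin r → ℝ) := by
        ext k
        simp [Finset.sum_apply, Pi.single_apply]
      rw [hx]
      refine Submodule.sum_mem _ fun j _ => ?_
      rcases le_total 0 (x j) with h | h
      · exact PointedCone.smul_mem _ h (Submodule.subset_span (Or.inl ⟨j, rfl⟩))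
      · have : x j • (Pi.single j 1 : Fin r → ℝ) = (-x j) • (-Pi.single j 1 : Fin r → ℝ) := by
          simp
        rw [this]
        exact PointedCone.smul_mem _ (by linarith)
          (Submodule.subset_span (Or.inr ⟨j, rfl⟩))
  face_mem := by
    rintro σ rfl τ hτ
    refine eq_top_iff.2 fun x _ => ?_
    exact hτ.mem_of_add_mem_left (y := -x) trivial trivial (by simp)
  inf_isFaceOf := by
    rintro σ rfl τ rfl
    simp

section Simplicial

variable {ι : Type*} [Fintype ι] (v : ι → V)

theorem mem_hull_image_iff (S : Set ι) (x : V) :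
    x ∈ PointedCone.hull ℝ (v '' S) ↔
      ∃ c : ι → ℝ, (∀ i, 0 ≤ c i) ∧ (∀ i, i ∉ S → c i = 0) ∧ x = ∑ i, c i • v i := by
  constructor
  · intro hx
    induction hx using Submodule.span_induction with
    | mem x h =>
      obtain ⟨i, hi, rfl⟩ := h
      refine ⟨Pi.single i 1, ?_, ?_, ?_⟩
      · intro j
        rcases eq_or_ne j i with rfl | h
        · simp
        · simp [h]
      · intro j hj
        have : j ≠ i := fun h => hj (h ▸ hi)
        simp [this]
      · simp [Pi.single_apply]
    | zero => exact ⟨0, by simp, by simp, by simp⟩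
    | add x y _ _ hx hy =>
      obtain ⟨c, h1, h2, rfl⟩ := hx
      obtain ⟨c', h1', h2', rfl⟩ := hy
      refine ⟨c + c', fun i => add_nonneg (h1 i) (h1' i), fun i hi => ?_, ?_⟩
      · simp [h2 i hi, h2' i hi]
      · simp [add_smul, Finset.sum_add_distrib]
    | smul a x _ hx =>
      obtain ⟨c, h1, h2, rfl⟩ := hx
      refine ⟨fun i => a * c i, fun i => mul_nonneg a.2 (h1 i), fun i hi => ?_, ?_⟩
      · simp [h2 i hi]
      · rw [Finset.smul_sum]
        refine Finset.sum_congr rfl fun i _ => ?_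
        rw [mul_smul]
        rfl
  · rintro ⟨c, h1, h2, rfl⟩
    refine Submodule.sum_mem _ fun i _ => ?_
    by_cases hi : i ∈ S
    · exact PointedCone.smul_mem _ (h1 i) (Submodule.subset_span ⟨i, hi, rfl⟩)
    · rw [h2 i hi, zero_smul]
      exact Submodule.zero_mem _

/-- A down-closed system of index sets for which nonnegative combinations are unique gives a
fan. -/
def fanOfUnique (Λ : AddSubgroup V) (hv : ∀ i, v i ∈ Λ) (𝒮 : Set (Set ι))
    (hdown : ∀ S ∈ 𝒮, ∀ T, T ⊆ S → T ∈ 𝒮)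
    (huniq : ∀ S ∈ 𝒮, ∀ S' ∈ 𝒮, ∀ c c' : ι → ℝ, (∀ i, 0 ≤ c i) → (∀ i, 0 ≤ c' i) →
      (∀ i, i ∉ S → c i = 0) → (∀ i, i ∉ S' → c' i = 0) →
      ∑ i, c i • v i = ∑ i, c' i • v i → c = c')
    (cones : Set (PointedCone ℝ V))
    (hcones : cones = (fun S : Set ι => PointedCone.hull ℝ (v '' S)) '' 𝒮) : Fan Λ where
  cones := cones
  finite := by
    rw [hcones]
    exact (Set.toFinite 𝒮).image _
  isRationalCone := by
    rw [hcones]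
    rintro σ ⟨S, _, rfl⟩
    refine ⟨v '' S, (Set.toFinite S).image _, ?_, rfl⟩
    rintro _ ⟨i, _, rfl⟩
    exact hv i
  face_mem := by
    rw [hcones]
    rintro σ ⟨S, hS, rfl⟩ τ hτ
    refine ⟨{i ∈ S | v i ∈ τ}, hdown S hS _ (Set.sep_subset _ _), ?_⟩
    refine le_antisymm ?_ ?_
    · refine Submodule.span_le.2 ?_
      rintro _ ⟨i, hi, rfl⟩
      exact hi.2
    · intro x hx
      obtain ⟨c, h1, h2, rfl⟩ := (mem_hull_image_iff v S x).1 (hτ.le hx)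
      refine Submodule.sum_mem _ fun i _ => ?_
      rcases (h1 i).eq_or_lt with h | h
      · rw [← h, zero_smul]
        exact Submodule.zero_mem _
      · have hiS : i ∈ S := by
          by_contra hi
          exact h.ne' (h2 i hi)
        refine PointedCone.smul_mem _ (h1 i) (Submodule.subset_span ⟨i, ⟨hiS, ?_⟩, rfl⟩)
        have hterm : ∀ j, c j • v j ∈ PointedCone.hull ℝ (v '' S) := by
          intro j
          by_cases hj : j ∈ S
          · exact PointedCone.smul_mem _ (h1 j) (Submodule.subset_span ⟨j, hj, rfl⟩)
          · rw [h2 j hj, zero_smul]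
            exact Submodule.zero_mem _
        have hmem := hτ.mem_of_sum_mem hterm hx i
        have := PointedCone.smul_mem τ (inv_nonneg.2 (h1 i)) hmem
        rwa [smul_smul, inv_mul_cancel₀ h.ne', one_smul] at this
  inf_isFaceOf := by
    have hface : ∀ S ∈ 𝒮, ∀ T, T ⊆ S →
        (PointedCone.hull ℝ (v '' T)).IsFaceOf (PointedCone.hull ℝ (v '' S)) := by
      intro S hS T hTS
      refine ⟨Submodule.span_mono (Set.image_mono hTS), ?_⟩
      intro x y a hx hy ha hxy
      obtain ⟨c, h1, h2, rfl⟩ := (mem_hull_image_iff v S x).1 hx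
      obtain ⟨c', h1', h2', rfl⟩ := (mem_hull_image_iff v S y).1 hy
      obtain ⟨d, k1, k2, k3⟩ := (mem_hull_image_iff v T _).1 hxy
      have := huniq S hS S hS (fun i => a * c i + c' i) d
        (fun i => add_nonneg (mul_nonneg ha.le (h1 i)) (h1' i)) k1
        (fun i hi => by simp [h2 i hi, h2' i hi]) (fun i hi => k2 i fun h => hi (hTS h))
        (by
          rw [← k3, Finset.smul_sum, ← Finset.sum_add_distrib]
          exact Finset.sum_congr rfl fun i _ => by rw [add_smul, mul_smul])
      refine (mem_hull_image_iff v T _).2 ⟨c, h1, fun i hi => ?_, rfl⟩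
      have e := congrFun this i
      simp only [k2 i hi] at e
      have := mul_nonneg ha.le (h1 i)
      have h0 : a * c i = 0 := by linarith [h1' i]
      exact (mul_eq_zero.1 h0).resolve_left ha.ne'
    rw [hcones]
    rintro σ ⟨S, hS, rfl⟩ τ ⟨S', hS', rfl⟩
    have hinter : (PointedCone.hull ℝ (v '' S) ⊓ PointedCone.hull ℝ (v '' S') :
        PointedCone ℝ V) = PointedCone.hull ℝ (v '' (S ∩ S')) := by
      refine le_antisymm ?_ (le_inf (Submodule.span_mono (Set.image_mono Set.inter_subset_left))
        (Submodule.span_mono (Set.image_mono Set.inter_subset_right)))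
      rintro x ⟨hx, hx'⟩
      obtain ⟨c, h1, h2, rfl⟩ := (mem_hull_image_iff v S x).1 hx
      obtain ⟨c', h1', h2', e⟩ := (mem_hull_image_iff v S' _).1 hx'
      have := huniq S hS S' hS' c c' h1 h1' h2 h2' e
      subst this
      refine (mem_hull_image_iff v _ _).2 ⟨c, h1, fun i hi => ?_, rfl⟩
      by_cases hiS : i ∈ S
      · exact h2' i fun h => hi ⟨hiS, h⟩
      · exact h2 i hiS
    dsimp only
    rw [hinter]
    exact ⟨hface S hS _ Set.inter_subset_left, hface S' hS' _ Set.inter_subset_right⟩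

end Simplicial

end Fans

/-! ## The vector space `Q_N`, the vectors `v_I` and the lattice they generate -/

/-- The set of two-element subsets of the set of labels. -/
abbrev Pairs (N : ℕ) : Type := {p : Sym2 (Fin N) // ¬ p.IsDiag}

/-- The coordinate `a_{i,j}` (set to `0` if `i = j`). -/
def coord {N : ℕ} (a : Pairs N → ℝ) (i j : Fin N) : ℝ :=
  if h : i = j then 0 else a ⟨s(i, j), by simpa using h⟩

/-- The linear map `Φ_N : a ↦ (a_i + a_j)_{i,j}`. -/
def Phi (N : ℕ) : (Fin N → ℝ) →ₗ[ℝ] (Pairs N → ℝ) where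
  toFun a p := Sym2.lift ⟨fun i j => a i + a j, fun i j => add_comm _ _⟩ p.1
  map_add' a b := by
    ext ⟨p, hp⟩
    induction p with
    | _ i j => simp; ring
  map_smul' c a := by
    ext ⟨p, hp⟩
    induction p with
    | _ i j => simp; ring

/-- The quotient space `Q_N` of the space of all `(a_{i,j})` by the image of `Φ_N`. -/
abbrev Q (N : ℕ) : Type := (Pairs N → ℝ) ⧸ LinearMap.range (Phi N)

/-- The canonical projection `q_N`. -/
def qmap (N : ℕ) : (Pairs N → ℝ) →ₗ[ℝ] Q N := (LinearMap.range (Phi N)).mkQ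

/-- The vector of distances between the ends of a tree with one bounded edge of length one, the
ends in `I` on one side of it and all other ends on the other side. -/
def sepVec {N : ℕ} (I : Finset (Fin N)) : Pairs N → ℝ := fun p =>
  if (∃ i ∈ p.1, i ∈ I) ∧ (∃ j ∈ p.1, j ∉ I) then 1 else 0

/-- The vector `v_I ∈ Q_N`. -/
def splitVec {N : ℕ} (I : Finset (Fin N)) : Q N := qmap N (sepVec I)

/-- The lattice `Λ_N ⊆ Q_N` generated by all `v_I` with `1 < |I| < N - 1`. -/
def lattice (N : ℕ) : AddSubgroup (Q N) :=
  AddSubgroup.closure {v | ∃ I : Finset (Fin N), 1 < I.card ∧ I.card + 1 < N ∧ v = splitVec I}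


/-! ## Abstract tropical curves and `M_{0,N,trop}` -/

/-- A rational tropical curve with exactly `N` ends, all of them marked. The graph is given by its
finite tree of vertices and bounded edges (a graph of genus zero has neither loops nor multiple
edges), the positive lengths of the bounded edges, and, for every `i`, the vertex at which the
`i`-th unbounded edge `x_i` is attached. Every vertex has valence at least three. -/
structure TropCurve (N : ℕ) where
  V : Type
  [fintypeV : Fintype V]
  G : SimpleGraph V
  isTree : G.IsTree
  len : G.edgeSet → ℝ
  len_pos : ∀ e, 0 < len e
  endVertex : Fin N → V
  three_le_valence : ∀ v : V,
    3 ≤ (G.neighborSet v).ncard + {i : Fin N | endVertex i = v}.ncard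

attribute [instance] TropCurve.fintypeV

namespace TropCurve

variable {N : ℕ}

/-- The edge `e` lies on the (unique) path from the vertex `u` to the vertex `v`. -/
def OnPath (C : TropCurve N) (e : Sym2 C.V) (u v : C.V) : Prop :=
  ∃ p : C.G.Walk u v, p.IsPath ∧ e ∈ p.edges

theorem OnPath.symm {C : TropCurve N} {e : Sym2 C.V} {u v : C.V} (h : C.OnPath e u v) :
    C.OnPath e v u := by
  obtain ⟨p, hp, he⟩ := h
  exact ⟨p.reverse, hp.reverse, by simpa using he⟩

/-- The distance between two vertices: the sum of the lengths of all edges on the path between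
them. -/
def dist (C : TropCurve N) (u v : C.V) : ℝ :=
  ∑ e : C.G.edgeSet, if C.OnPath e u v then C.len e else 0

theorem dist_comm (C : TropCurve N) (u v : C.V) : C.dist u v = C.dist v u := by
  unfold dist
  refine Finset.sum_congr rfl fun e _ => ?_
  have : C.OnPath e u v ↔ C.OnPath e v u := ⟨OnPath.symm, OnPath.symm⟩
  simp only [this]

/-- The vector of all distances between the marked ends. -/
def distVec (C : TropCurve N) : Pairs N → ℝ := fun p =>
  Sym2.lift ⟨fun i j => C.dist (C.endVertex i) (C.endVertex j),
    fun _ _ => C.dist_comm _ _⟩ p.1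

/-- An isomorphism of marked tropical curves: an isomorphism of the underlying graphs that
preserves the lengths of the bounded edges and the marked ends. -/
structure Iso (C C' : TropCurve N) where
  graphIso : C.G ≃g C'.G
  len_map : ∀ e : C.G.edgeSet, C'.len (graphIso.mapEdgeSet e) = C.len e
  endVertex_map : ∀ i, C'.endVertex i = graphIso (C.endVertex i)

theorem onPath_map {C C' : TropCurve N} (φ : C.G ≃g C'.G) {e : Sym2 C.V} {u v : C.V}
    (h : C.OnPath e u v) : C'.OnPath (e.map φ) (φ u) (φ v) := by
  obtain ⟨p, hp, he⟩ := h
  refine ⟨p.map φ.toHom, SimpleGraph.Walk.IsPath.map φ.injective hp, ?_⟩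
  rw [SimpleGraph.Walk.edges_map]
  exact List.mem_map.2 ⟨e, he, rfl⟩

theorem onPath_map_iff {C C' : TropCurve N} (φ : C.G ≃g C'.G) {e : Sym2 C.V} {u v : C.V} :
    C'.OnPath (e.map φ) (φ u) (φ v) ↔ C.OnPath e u v := by
  refine ⟨fun h => ?_, onPath_map φ⟩
  have := onPath_map φ.symm h
  rw [Sym2.map_map] at this
  simpa [Function.comp_def] using this

theorem Iso.dist_eq {C C' : TropCurve N} (φ : Iso C C') (u v : C.V) :
    C'.dist (φ.graphIso u) (φ.graphIso v) = C.dist u v := by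
  unfold dist
  symm
  refine Fintype.sum_equiv φ.graphIso.mapEdgeSet _ _ fun e => ?_
  have h := onPath_map_iff φ.graphIso (e := (e : Sym2 C.V)) (u := u) (v := v)
  have he : ((φ.graphIso.mapEdgeSet e : C'.G.edgeSet) : Sym2 C'.V) = (e : Sym2 C.V).map φ.graphIso := rfl
  rw [he, φ.len_map]
  simp only [h]

theorem Iso.distVec_eq {C C' : TropCurve N} (φ : Iso C C') : C.distVec = C'.distVec := by
  ext ⟨p, hp⟩
  induction p with
  | _ i j =>
    simp only [distVec, Sym2.lift_mk, φ.endVertex_map, φ.dist_eq]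

/-- The set of marked ends lying behind the oriented bounded edge `d`, that is, on the other side
of this edge than its starting point. -/
def endsBehind (C : TropCurve N) (d : C.G.Dart) : Finset (Fin N) :=
  Finset.univ.filter fun i => C.OnPath d.edge d.fst (C.endVertex i)

end TropCurve

/-- The space `M_{0,N,trop}`: isomorphism classes of `N`-marked rational tropical curves with
exactly `N` ends. -/
def M0 (N : ℕ) : Type 1 :=
  Quot fun C C' : TropCurve N => Nonempty (TropCurve.Iso C C')

/-- The embedding `φ_N : M_{0,N,trop} → Q_N`. -/
def phi (N : ℕ) : M0 N → Q N :=
  Quot.lift (fun C => qmap N C.distVec) fun _ _ ⟨φ⟩ => congrArg (qmap N) φ.distVec_eq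

/-! ## The fan structure on `M_{0,N,trop}` -/

section FanStructure

variable {N : ℕ}

/-- The cone in `Q_N` of all curves obtained from the curve `C` by giving the bounded edges in `A`
arbitrary lengths in `[0,∞)` and contracting all the other ones; it is generated by the vectors
`v_I` where `I` runs over the sets of ends behind the edges in `A`. -/
def curveCone (C : TropCurve N) (A : Set C.G.Dart) : PointedCone ℝ (Q N) :=
  PointedCone.hull ℝ ((fun d => splitVec (C.endsBehind d)) '' A)

theorem sepVec_compl (I : Finset (Fin N)) : sepVec Iᶜ = sepVec I := by
  ext p
  unfold sepVec
  simp only [Finset.mem_compl, not_not]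
  exact if_congr and_comm rfl rfl

theorem splitVec_compl (I : Finset (Fin N)) : splitVec Iᶜ = splitVec I := by
  unfold splitVec
  rw [sepVec_compl]

theorem splitVec_eq_zero_of_card_le_one {I : Finset (Fin N)} (h : I.card ≤ 1) :
    splitVec I = 0 := by
  unfold splitVec qmap
  rw [Submodule.mkQ_apply, Submodule.Quotient.mk_eq_zero]
  refine ⟨fun i => if i ∈ I then 1 else 0, ?_⟩
  ext ⟨p, hp⟩
  induction p with
  | _ i j =>
    have hij : i ≠ j := by simpa using hp
    have hnot : ¬ (i ∈ I ∧ j ∈ I) := fun hh =>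
      hij (Finset.card_le_one.1 h i hh.1 j hh.2)
    by_cases h1 : i ∈ I <;> by_cases h2 : j ∈ I <;> simp_all [Phi, sepVec]

theorem splitVec_mem_lattice (I : Finset (Fin N)) : splitVec I ∈ lattice N := by
  by_cases h1 : 1 < I.card
  · by_cases h2 : I.card + 1 < N
    · exact AddSubgroup.subset_closure ⟨I, h1, h2, rfl⟩
    · have : Iᶜ.card ≤ 1 := by
        rw [Finset.card_compl, Fintype.card_fin]
        omega
      rw [← splitVec_compl, splitVec_eq_zero_of_card_le_one this]
      exact zero_mem _
  · rw [splitVec_eq_zero_of_card_le_one (not_lt.1 h1)]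
    exact zero_mem _

/-! ### Compatibility of the splits of a curve -/

section Compat

variable (C : TropCurve N)

theorem onPath_iff (e : Sym2 C.V) (u v : C.V) :
    C.OnPath e u v ↔ ¬ (C.G.deleteEdges {e}).Reachable u v := by
  constructor
  · rintro ⟨p, hp, he⟩ ⟨w⟩
    have hw := w.toPath
    have h1 : ((hw : (C.G.deleteEdges {e}).Walk u v).mapLe (C.G.deleteEdges_le {e})).IsPath :=
      hw.2.mapLe _
    have h2 := (C.isTree.isAcyclic.subsingleton_path u v).elim ⟨p, hp⟩ ⟨_, h1⟩
    have h3 : p = (hw : (C.G.deleteEdges {e}).Walk u v).mapLe (C.G.deleteEdges_le {e}) :=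
      congrArg Subtype.val h2
    rw [h3, SimpleGraph.Walk.edges_mapLe_eq_edges] at he
    have := SimpleGraph.Walk.edges_subset_edgeSet _ he
    simp at this
  · intro h
    obtain ⟨p, hp, -⟩ := C.isTree.existsUnique_path u v
    refine ⟨p, hp, ?_⟩
    by_contra he
    exact h ⟨p.toDeleteEdge e he⟩

theorem reachable_endpoint (x y v : C.V) :
    (C.G.deleteEdges {s(x, y)}).Reachable v x ∨ (C.G.deleteEdges {s(x, y)}).Reachable v y := by
  obtain ⟨w⟩ := C.isTree.connected.preconnected v x
  induction w with
  | nil => exact Or.inl (SimpleGraph.Reachable.refl _)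
  | @cons a b c hab w ih =>
    by_cases he : s(a, b) = s(c, y)
    · rcases Sym2.eq_iff.1 he with ⟨rfl, rfl⟩ | ⟨rfl, rfl⟩
      · exact Or.inl (SimpleGraph.Reachable.refl _)
      · exact Or.inr (SimpleGraph.Reachable.refl _)
    · have hadj : (C.G.deleteEdges {s(c, y)}).Adj a b := by
        rw [SimpleGraph.deleteEdges_adj]
        exact ⟨hab, he⟩
      exact ih.imp hadj.reachable.trans hadj.reachable.trans

theorem reachable_transfer {e f : Sym2 C.V} {u v x : C.V} (hx : x ∈ e)
    (huv : (C.G.deleteEdges {f}).Reachable u v)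
    (hux : ¬ (C.G.deleteEdges {f}).Reachable u x) : (C.G.deleteEdges {e}).Reachable u v := by
  obtain ⟨w⟩ := huv
  have hw : e ∉ w.edges := by
    intro he
    have : x ∈ w.support := SimpleGraph.Walk.mem_support_of_mem_edges he hx
    exact hux ⟨w.takeUntil x this⟩
  have hw' : e ∉ (w.mapLe (C.G.deleteEdges_le {f})).edges := by
    rwa [SimpleGraph.Walk.edges_mapLe_eq_edges]
  exact ⟨(w.mapLe (C.G.deleteEdges_le {f})).toDeleteEdge e hw'⟩

/-- For any two oriented edges of a tree, one of the four intersections of the sides is empty. -/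
theorem endsBehind_compat (d d' : C.G.Dart) :
    Disjoint (C.endsBehind d) (C.endsBehind d') ∨ C.endsBehind d ⊆ C.endsBehind d' ∨
    C.endsBehind d' ⊆ C.endsBehind d ∨ (C.endsBehind d)ᶜ ⊆ C.endsBehind d' := by
  have hmem : ∀ (d : C.G.Dart) (i : Fin N), i ∈ C.endsBehind d ↔
      ¬ (C.G.deleteEdges {d.edge}).Reachable d.fst (C.endVertex i) := by
    intro d i
    simp [TropCurve.endsBehind, onPath_iff]
  by_cases hee : d.edge = d'.edge
  · by_cases hf : (C.G.deleteEdges {d.edge}).Reachable d.fst d'.fst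
    · right; left
      intro i hi
      rw [hmem] at hi ⊢
      rw [← hee]
      exact fun h => hi (hf.trans h)
    · right; right; right
      intro i hi
      rw [Finset.mem_compl, hmem, not_not] at hi
      rw [hmem, ← hee]
      exact fun h => hf (hi.trans h.symm)
  · by_cases hf : (C.G.deleteEdges {d'.edge}).Reachable d'.fst d.fst
    · -- all ends behind `d'` lie in the same class with respect to `d`
      have hclass : ∀ i ∈ C.endsBehind d', ∀ j ∈ C.endsBehind d',
          (C.G.deleteEdges {d.edge}).Reachable (C.endVertex i) (C.endVertex j) := by
        intro i hi j hj
        rw [hmem] at hi hj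
        have hx : d.fst ∈ d.edge := by simp [SimpleGraph.Dart.edge, Sym2.mem_iff]
        refine reachable_transfer C (f := d'.edge) hx ?_ (fun h => hi (hf.trans h.symm))
        have h2 : ∀ k, ¬ (C.G.deleteEdges {d'.edge}).Reachable d'.fst (C.endVertex k) →
            (C.G.deleteEdges {d'.edge}).Reachable (C.endVertex k) d'.snd := by
          intro k hk
          exact (reachable_endpoint C d'.fst d'.snd (C.endVertex k)).resolve_left
            fun h => hk h.symm
        exact (h2 i hi).trans (h2 j hj).symm
      by_cases hex : ∃ i ∈ C.endsBehind d', i ∈ C.endsBehind d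
      · obtain ⟨i, hi, hi'⟩ := hex
        right; right; left
        intro j hj
        rw [hmem] at hi' ⊢
        exact fun h => hi' (h.trans (hclass j hj i hi))
      · left
        rw [Finset.disjoint_left]
        exact fun i hi hi' => hex ⟨i, hi', hi⟩
    · have hclass : ∀ i ∉ C.endsBehind d', ∀ j ∉ C.endsBehind d',
          (C.G.deleteEdges {d.edge}).Reachable (C.endVertex i) (C.endVertex j) := by
        intro i hi j hj
        rw [hmem, not_not] at hi hj
        have hx : d.fst ∈ d.edge := by simp [SimpleGraph.Dart.edge, Sym2.mem_iff]
        exact reachable_transfer C (f := d'.edge) hx (hi.symm.trans hj) (fun h => hf (hi.trans h))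
      by_cases hex : ∃ i ∉ C.endsBehind d', i ∈ C.endsBehind d
      · obtain ⟨i, hi, hi'⟩ := hex
        right; right; right
        intro j hj
        by_contra hj'
        rw [Finset.mem_compl, hmem, not_not] at hj
        rw [hmem] at hi'
        exact hi' (hj.trans (hclass j hj' i hi))
      · right; left
        intro i hi
        by_contra hi'
        exact hex ⟨i, hi', hi⟩

end Compat

/-! ### Uniqueness of the representation of a point by compatible splits -/

section Laminar

variable (r : Fin N)

/-- A system of nontrivial subsets of the set of labels different from `r`, any two of them being
disjoint or nested. -/
def IsLaminar (S : Set (Finset (Fin N))) : Prop :=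
  (∀ I ∈ S, r ∉ I ∧ 1 < I.card ∧ I.card + 1 < N) ∧
  ∀ I ∈ S, ∀ J ∈ S, Disjoint I J ∨ I ⊆ J ∨ J ⊆ I

variable {r}

theorem IsLaminar.mono {S T : Set (Finset (Fin N))} (hS : IsLaminar r S) (h : T ⊆ S) :
    IsLaminar r T :=
  ⟨fun I hI => hS.1 I (h hI), fun I hI J hJ => hS.2 I (h hI) J (h hJ)⟩

/-- The total weight of all sets containing both `x` and `y`. -/
def pairWeight (c : Finset (Fin N) → ℝ) (x y : Fin N) : ℝ :=
  ∑ I, if x ∈ I ∧ y ∈ I then c I else 0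

theorem exists_of_pairWeight_pos {c : Finset (Fin N) → ℝ} {x y : Fin N}
    (h : 0 < pairWeight c x y) : ∃ I, 0 < c I ∧ x ∈ I ∧ y ∈ I := by
  by_contra hne
  push Not at hne
  refine h.not_ge (Finset.sum_nonpos fun I _ => ?_)
  split_ifs with hI
  · by_contra hc
    exact hne I (not_le.1 hc) hI.1 hI.2
  · exact le_rfl

theorem le_pairWeight {c : Finset (Fin N) → ℝ} (hc : ∀ I, 0 ≤ c I) {I : Finset (Fin N)}
    {x y : Fin N} (hx : x ∈ I) (hy : y ∈ I) : c I ≤ pairWeight c x y := by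
  have := Finset.single_le_sum (f := fun I => if x ∈ I ∧ y ∈ I then c I else 0)
    (fun J _ => by
      show 0 ≤ if x ∈ J ∧ y ∈ J then c J else 0
      split_ifs
      · exact hc J
      · exact le_rfl) (Finset.mem_univ I)
  simpa [hx, hy, pairWeight] using this

theorem exists_pairWeight_eq_zero (hN : 3 ≤ N) {S : Set (Finset (Fin N))} (hS : IsLaminar r S)
    {c : Finset (Fin N) → ℝ} (hc : ∀ I, 0 ≤ c I) (hcS : ∀ I, I ∉ S → c I = 0) :
    ∃ x y, x ≠ r ∧ y ≠ r ∧ x ≠ y ∧ pairWeight c x y = 0 := by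
  have hnn : ∀ x y, 0 ≤ pairWeight c x y := fun x y =>
    Finset.sum_nonneg fun I _ => by
      split_ifs
      · exact hc I
      · exact le_rfl
  by_cases hne : (Finset.univ.filter fun I => 0 < c I).Nonempty
  · obtain ⟨I, hI, hmax⟩ := Finset.exists_max_image _ Finset.card hne
    have hIpos : 0 < c I := (Finset.mem_filter.1 hI).2
    have hIS : ∀ J, 0 < c J → J ∈ S := fun J hJ => by
      by_contra h
      exact hJ.ne' (hcS J h)
    obtain ⟨hr, h1, h2⟩ := hS.1 I (hIS I hIpos)
    obtain ⟨x, hx⟩ : I.Nonempty := Finset.card_pos.1 (by omega)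
    obtain ⟨y, hy⟩ : (insert r I)ᶜ.Nonempty := by
      rw [← Finset.card_pos, Finset.card_compl, Fintype.card_fin, Finset.card_insert_of_notMem hr]
      omega
    simp only [Finset.mem_compl, Finset.mem_insert, not_or] at hy
    refine ⟨x, y, fun h => hr (h ▸ hx), hy.1, fun h => hy.2 (h ▸ hx), ?_⟩
    by_contra h0
    obtain ⟨J, hJ, hxJ, hyJ⟩ := exists_of_pairWeight_pos ((hnn x y).lt_of_ne' h0)
    rcases hS.2 I (hIS I hIpos) J (hIS J hJ) with h | h | h
    · exact Finset.disjoint_left.1 h hx hxJ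
    · have hss : I ⊂ J := Finset.ssubset_iff_subset_ne.2 ⟨h, fun e => hy.2 (e ▸ hyJ)⟩
      have := hmax J (Finset.mem_filter.2 ⟨Finset.mem_univ _, hJ⟩)
      have := Finset.card_lt_card hss
      omega
    · exact hy.2 (h hyJ)
  · have h2 : 1 < ({r}ᶜ : Finset (Fin N)).card := by
      rw [Finset.card_compl, Fintype.card_fin, Finset.card_singleton]
      omega
    obtain ⟨x, hx, y, hy, hxy⟩ := Finset.one_lt_card.1 h2
    refine ⟨x, y, by simpa using hx, by simpa using hy, hxy, ?_⟩
    by_contra h0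
    obtain ⟨J, hJ, -⟩ := exists_of_pairWeight_pos ((hnn x y).lt_of_ne' h0)
    exact hne ⟨J, by simpa using hJ⟩

theorem mem_of_max {S S' : Set (Finset (Fin N))} (hS : IsLaminar r S) (hS' : IsLaminar r S')
    {c c' : Finset (Fin N) → ℝ} (hc : ∀ I, 0 ≤ c I)
    (hcS : ∀ I, I ∉ S → c I = 0) (hcS' : ∀ I, I ∉ S' → c' I = 0)
    (h : ∀ x y, x ≠ r → y ≠ r → x ≠ y → pairWeight c x y = pairWeight c' x y)
    {I : Finset (Fin N)} (hI : 0 < c I) (hmax : ∀ J, 0 < c' J → J.card ≤ I.card) : 0 < c' I := by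
  have hIS : I ∈ S := by
    by_contra h
    exact hI.ne' (hcS I h)
  have hS'mem : ∀ J, 0 < c' J → J ∈ S' := fun J hJ => by
    by_contra h
    exact hJ.ne' (hcS' J h)
  obtain ⟨hr, h1, h2⟩ := hS.1 I hIS
  obtain ⟨x, hx, y, hy, hxy⟩ := Finset.one_lt_card.1 h1
  have key : ∀ z ∈ I, z ≠ x → ∃ J, 0 < c' J ∧ x ∈ J ∧ z ∈ J := by
    intro z hz hzx
    refine exists_of_pairWeight_pos ?_
    rw [← h x z (fun e => hr (e ▸ hx)) (fun e => hr (e ▸ hz)) hzx.symm]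
    exact hI.trans_le (le_pairWeight hc hx hz)
  have hne : (Finset.univ.filter fun J => 0 < c' J ∧ x ∈ J).Nonempty := by
    obtain ⟨J, hJ, hxJ, -⟩ := key y hy hxy.symm
    exact ⟨J, by simp [hJ, hxJ]⟩
  obtain ⟨J, hJ, hJmax⟩ := Finset.exists_max_image _ Finset.card hne
  obtain ⟨hJpos, hxJ⟩ := (Finset.mem_filter.1 hJ).2
  have hsub : I ⊆ J := by
    intro z hz
    by_cases hzx : z = x
    · exact hzx ▸ hxJ
    · obtain ⟨K, hK, hxK, hzK⟩ := key z hz hzx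
      have hKJ := hJmax K (by simp [hK, hxK])
      rcases hS'.2 J (hS'mem J hJpos) K (hS'mem K hK) with h | h | h
      · exact absurd hxK (Finset.disjoint_left.1 h hxJ)
      · rw [Finset.eq_of_subset_of_card_le h hKJ]
        exact hzK
      · exact h hzK
  rw [Finset.eq_of_subset_of_card_le hsub (hmax J hJpos)]
  exact hJpos

theorem eq_of_pairWeight_eq {S S' : Set (Finset (Fin N))} (hS : IsLaminar r S)
    (hS' : IsLaminar r S') (n : ℕ) : ∀ c c' : Finset (Fin N) → ℝ, (∀ I, 0 ≤ c I) →
      (∀ I, 0 ≤ c' I) → (∀ I, I ∉ S → c I = 0) → (∀ I, I ∉ S' → c' I = 0) →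
      (∀ x y, x ≠ r → y ≠ r → x ≠ y → pairWeight c x y = pairWeight c' x y) →
      (Finset.univ.filter fun I => 0 < c I).card + (Finset.univ.filter fun I => 0 < c' I).card ≤ n →
      c = c' := by
  induction n with
  | zero =>
    intro c c' hc hc' _ _ _ hcard
    have h1 : (Finset.univ.filter fun I => 0 < c I) = ∅ := Finset.card_eq_zero.1 (by omega)
    have h2 : (Finset.univ.filter fun I => 0 < c' I) = ∅ := Finset.card_eq_zero.1 (by omega)
    ext I
    have e1 : ¬ 0 < c I := fun h => by
      have : I ∈ (∅ : Finset (Finset (Fin N))) := h1 ▸ (by simp [h])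
      simp at this
    have e2 : ¬ 0 < c' I := fun h => by
      have : I ∈ (∅ : Finset (Finset (Fin N))) := h2 ▸ (by simp [h])
      simp at this
    linarith [hc I, hc' I]
  | succ n ih =>
    intro c c' hc hc' hcS hcS' h hcard
    by_cases hne : (Finset.univ.filter fun I => 0 < c I ∨ 0 < c' I).Nonempty
    swap
    · ext I
      have : ¬ (0 < c I ∨ 0 < c' I) := fun hI => hne ⟨I, by simpa using hI⟩
      push Not at this
      linarith [hc I, hc' I]
    obtain ⟨I, hI, hmax⟩ := Finset.exists_max_image _ Finset.card hne
    have hI' := (Finset.mem_filter.1 hI).2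
    have hboth : 0 < c I ∧ 0 < c' I := by
      rcases hI' with h0 | h0
      · exact ⟨h0, mem_of_max hS hS' hc hcS hcS' h h0 fun J hJ => hmax J (by simp [hJ])⟩
      · exact ⟨mem_of_max hS' hS hc' hcS' hcS (fun x y hx hy hxy => (h x y hx hy hxy).symm) h0
          fun J hJ => hmax J (by simp [hJ]), h0⟩
    set m := min (c I) (c' I) with hm
    have hm0 : 0 < m := lt_min hboth.1 hboth.2
    have hpw : ∀ (b : Finset (Fin N) → ℝ) (x y : Fin N),
        pairWeight (fun J => b J - if J = I then m else 0) x y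
          = pairWeight b x y - if x ∈ I ∧ y ∈ I then m else 0 := by
      intro b x y
      unfold pairWeight
      have : ∀ J : Finset (Fin N), (if x ∈ J ∧ y ∈ J then b J - (if J = I then m else 0) else 0)
          = (if x ∈ J ∧ y ∈ J then b J else 0)
            - (if J = I then (if x ∈ I ∧ y ∈ I then m else 0) else 0) := by
        intro J
        by_cases hJ : J = I
        · subst hJ
          by_cases hxy : x ∈ J ∧ y ∈ J <;> simp [hxy]
        · simp [hJ]
      simp only [this, Finset.sum_sub_distrib]
      simp
    have hsub : ∀ (b : Finset (Fin N) → ℝ), (Finset.univ.filter fun J => 0 < b J -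
        if J = I then m else 0) ⊆ Finset.univ.filter fun J => 0 < b J := by
      intro b J hJ
      simp only [Finset.mem_filter, Finset.mem_univ, true_and] at hJ ⊢
      split_ifs at hJ <;> linarith
    have hnn : ∀ (b : Finset (Fin N) → ℝ), (∀ J, 0 ≤ b J) → m ≤ b I →
        ∀ J, 0 ≤ b J - if J = I then m else 0 := by
      intro b hb hmb J
      split_ifs with hJ
      · subst hJ
        linarith
      · linarith [hb J]
    have hsupp : ∀ (b : Finset (Fin N) → ℝ) (T : Set (Finset (Fin N))), 0 < b I →
        (∀ J, J ∉ T → b J = 0) → ∀ J, J ∉ T → (b J - if J = I then m else 0) = 0 := by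
      intro b T hbI hb J hJ
      have : J ≠ I := by
        rintro rfl
        exact hbI.ne' (hb _ hJ)
      simp [this, hb J hJ]
    have heq := ih (fun J => c J - if J = I then m else 0) (fun J => c' J - if J = I then m else 0)
      (hnn c hc (min_le_left _ _)) (hnn c' hc' (min_le_right _ _))
      (hsupp c S hboth.1 hcS) (hsupp c' S' hboth.2 hcS')
      (fun x y hx hy hxy => by rw [hpw, hpw, h x y hx hy hxy]) (by
        have l1 := Finset.card_le_card (hsub c)
        have l2 := Finset.card_le_card (hsub c')
        rcases min_choice (c I) (c' I) with hmin | hmin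
        · have : (Finset.univ.filter fun J => 0 < c J - if J = I then m else 0) ⊂
              Finset.univ.filter fun J => 0 < c J := by
            refine Finset.ssubset_iff_subset_ne.2 ⟨hsub c, fun e => ?_⟩
            have hIm : I ∈ Finset.univ.filter fun J => 0 < c J := by simp [hboth.1]
            rw [← e] at hIm
            simp [hm, hmin] at hIm
          have := Finset.card_lt_card this
          omega
        · have : (Finset.univ.filter fun J => 0 < c' J - if J = I then m else 0) ⊂
              Finset.univ.filter fun J => 0 < c' J := by
            refine Finset.ssubset_iff_subset_ne.2 ⟨hsub c', fun e => ?_⟩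
            have hIm : I ∈ Finset.univ.filter fun J => 0 < c' J := by simp [hboth.2]
            rw [← e] at hIm
            simp [hm, hmin] at hIm
          have := Finset.card_lt_card this
          omega)
    ext J
    have := congrFun heq J
    simpa using this

theorem sum_splitVec_injective (hN : 3 ≤ N) {S S' : Set (Finset (Fin N))} (hS : IsLaminar r S)
    (hS' : IsLaminar r S') (c c' : Finset (Fin N) → ℝ) (hc : ∀ I, 0 ≤ c I) (hc' : ∀ I, 0 ≤ c' I)
    (hcS : ∀ I, I ∉ S → c I = 0) (hcS' : ∀ I, I ∉ S' → c' I = 0)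
    (h : ∑ I, c I • splitVec I = ∑ I, c' I • splitVec I) : c = c' := by
  have hq : ∀ b : Finset (Fin N) → ℝ,
      ∑ I, b I • splitVec I = qmap N (∑ I, b I • sepVec I) := by
    intro b
    simp [splitVec, map_sum]
  rw [hq, hq, qmap, Submodule.mkQ_apply, Submodule.mkQ_apply, Submodule.Quotient.eq] at h
  obtain ⟨a, ha⟩ := h
  have hsum : ∀ (b : Finset (Fin N) → ℝ) (T : Set (Finset (Fin N))), IsLaminar r T →
      (∀ I, I ∉ T → b I = 0) → ∀ (x y : Fin N) (hx : x ≠ r) (hy : y ≠ r) (hxy : x ≠ y),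
      (∑ I, b I • sepVec I) ⟨s(r, x), by simpa using hx.symm⟩
        + (∑ I, b I • sepVec I) ⟨s(r, y), by simpa using hy.symm⟩
        - (∑ I, b I • sepVec I) ⟨s(x, y), by simpa using hxy⟩ = 2 * pairWeight b x y := by
    intro b T hT hb x y hx hy hxy
    unfold pairWeight
    simp only [Finset.sum_apply, Pi.smul_apply, smul_eq_mul]
    rw [← Finset.sum_add_distrib, ← Finset.sum_sub_distrib, Finset.mul_sum]
    refine Finset.sum_congr rfl fun I _ => ?_
    by_cases hI : I ∈ T
    · have hr := (hT.1 I hI).1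
      by_cases h1 : x ∈ I <;> by_cases h2 : y ∈ I <;> (simp [sepVec, h1, h2, hr]; try ring)
    · simp [hb I hI]
  have hpair : ∀ x y, x ≠ r → y ≠ r → x ≠ y → pairWeight c x y - pairWeight c' x y = a r := by
    intro x y hx hy hxy
    have e1 := hsum c S hS hcS x y hx hy hxy
    have e2 := hsum c' S' hS' hcS' x y hx hy hxy
    have f1 := congrFun ha ⟨s(r, x), by simpa using hx.symm⟩
    have f2 := congrFun ha ⟨s(r, y), by simpa using hy.symm⟩
    have f3 := congrFun ha ⟨s(x, y), by simpa using hxy⟩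
    rw [Pi.sub_apply] at f1 f2 f3
    simp only [Phi, LinearMap.coe_mk, AddHom.coe_mk, Sym2.lift_mk] at f1 f2 f3
    linarith
  have hnn : ∀ b : Finset (Fin N) → ℝ, (∀ I, 0 ≤ b I) → ∀ x y, 0 ≤ pairWeight b x y :=
    fun b hb x y => Finset.sum_nonneg fun I _ => by
      split_ifs
      · exact hb I
      · exact le_rfl
  have har : a r = 0 := by
    obtain ⟨x, y, hx, hy, hxy, h0⟩ := exists_pairWeight_eq_zero hN hS hc hcS
    obtain ⟨x', y', hx', hy', hxy', h0'⟩ := exists_pairWeight_eq_zero hN hS' hc' hcS'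
    have e := hpair x y hx hy hxy
    have e' := hpair x' y' hx' hy' hxy'
    linarith [hnn c hc x' y', hnn c' hc' x y]
  refine eq_of_pairWeight_eq hS hS' _ c c' hc hc' hcS hcS' (fun x y hx hy hxy => ?_) le_rfl
  linarith [hpair x y hx hy hxy]

end Laminar

/-- The representative, among a set of labels and its complement, that does not contain `r`. -/
def awayFrom (r : Fin N) (I : Finset (Fin N)) : Finset (Fin N) := if r ∈ I then Iᶜ else I

theorem splitVec_awayFrom (r : Fin N) (I : Finset (Fin N)) :
    splitVec (awayFrom r I) = splitVec I := by
  unfold awayFrom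
  split_ifs
  · exact splitVec_compl I
  · rfl

theorem notMem_awayFrom (r : Fin N) (I : Finset (Fin N)) : r ∉ awayFrom r I := by
  unfold awayFrom
  split_ifs with h
  · simpa using h
  · exact h

/-- The nontrivial sets of ends, not containing `r`, on one side of an edge in `A`. -/
def sides (r : Fin N) (C : TropCurve N) (A : Set C.G.Dart) : Set (Finset (Fin N)) :=
  {I | 1 < I.card ∧ I.card + 1 < N ∧ ∃ d ∈ A, I = awayFrom r (C.endsBehind d)}

theorem sides_isLaminar (r : Fin N) (C : TropCurve N) (A : Set C.G.Dart) :
    IsLaminar r (sides r C A) := by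
  refine ⟨?_, ?_⟩
  · rintro I ⟨h1, h2, d, -, rfl⟩
    exact ⟨notMem_awayFrom _ _, h1, h2⟩
  · rintro _ ⟨-, -, d, -, rfl⟩ _ ⟨-, -, d', -, rfl⟩
    have h := endsBehind_compat C d d'
    generalize C.endsBehind d = I at h
    generalize C.endsBehind d' = J at h
    unfold awayFrom
    simp only [Finset.disjoint_left, Finset.subset_iff, Finset.mem_compl] at h
    split_ifs with hI hJ hJ <;>
      simp only [Finset.disjoint_left, Finset.subset_iff, Finset.mem_compl, not_not] <;>
      rcases h with h | h | h | h <;> grind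

theorem curveCone_eq (r : Fin N) (C : TropCurve N) (A : Set C.G.Dart) :
    curveCone C A = PointedCone.hull ℝ (splitVec '' sides r C A) := by
  refine le_antisymm (Submodule.span_le.2 ?_) (Submodule.span_le.2 ?_)
  · rintro _ ⟨d, hd, rfl⟩
    dsimp only
    rw [← splitVec_awayFrom r]
    by_cases h1 : 1 < (awayFrom r (C.endsBehind d)).card
    · by_cases h2 : (awayFrom r (C.endsBehind d)).card + 1 < N
      · exact Submodule.subset_span ⟨_, ⟨h1, h2, d, hd, rfl⟩, rfl⟩
      · have : (awayFrom r (C.endsBehind d))ᶜ.card ≤ 1 := by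
          rw [Finset.card_compl, Fintype.card_fin]
          omega
        rw [← splitVec_compl, splitVec_eq_zero_of_card_le_one this]
        exact Submodule.zero_mem _
    · rw [splitVec_eq_zero_of_card_le_one (not_lt.1 h1)]
      exact Submodule.zero_mem _
  · rintro _ ⟨_, ⟨-, -, d, hd, rfl⟩, rfl⟩
    rw [splitVec_awayFrom]
    exact Submodule.subset_span ⟨d, hd, rfl⟩

/-- The fan structure of `M_{0,N,trop}` in `Q_N` with lattice `Λ_N`: its cones are the cones of
all curves and their degenerations. -/
def moduliFan (N : ℕ) (hN : 3 ≤ N) : Fan (lattice N) :=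
  fanOfUnique splitVec (lattice N) splitVec_mem_lattice
    {S | ∃ C : TropCurve N, ∃ A, S = sides (⟨0, by omega⟩ : Fin N) C A}
    (by
      rintro S ⟨C, A, rfl⟩ T hT
      refine ⟨C, {d ∈ A | awayFrom (⟨0, by omega⟩ : Fin N) (C.endsBehind d) ∈ T}, ?_⟩
      ext I
      constructor
      · intro hI
        obtain ⟨h1, h2, d, hd, rfl⟩ := hT hI
        exact ⟨h1, h2, d, ⟨hd, hI⟩, rfl⟩
      · rintro ⟨-, -, d, hd, rfl⟩
        exact hd.2)
    (by
      rintro _ ⟨C, A, rfl⟩ _ ⟨C', A', rfl⟩ c c' hc hc' h h' heq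
      exact sum_splitVec_injective hN (sides_isLaminar _ C A) (sides_isLaminar _ C' A')
        c c' hc hc' h h' heq)
    {σ | ∃ C : TropCurve N, ∃ A : Set C.G.Dart, σ = curveCone C A}
    (by
      ext σ
      constructor
      · rintro ⟨C, A, rfl⟩
        exact ⟨_, ⟨C, A, rfl⟩, (curveCone_eq _ C A).symm⟩
      · rintro ⟨_, ⟨C, A, rfl⟩, rfl⟩
        exact ⟨C, A, (curveCone_eq _ C A).symm⟩)

end FanStructure

/-! ## Labeled tropical curves in `ℝ^r` -/

/-- The directions of the `n + m` ends of a labeled `n`-marked curve of degree `Δ`: zero for the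
first `n` ends, and given by `Δ` for the others. -/
def endDir {n m r : ℕ} (Δ : Fin m → Fin r → ℤ) : Fin (n + m) → Fin r → ℤ :=
  Fin.append (fun _ => 0) Δ

/-- A labeled `n`-marked tropical curve in `ℝ^r` of degree `Δ`: an abstract curve with `n + m` ends
together with a continuous map `h` to `ℝ^r` that is affine with integral direction on every edge,
has the prescribed directions on the ends, and is balanced at all vertices. Such a map is given by
the images `pos v` of the vertices and by the directions `dir d` of the oriented bounded edges; on
an end `x_i` attached at `v` it is `t ↦ pos v + t • endDir Δ i`. -/
structure LabeledCurve (n r : ℕ) {m : ℕ} (Δ : Fin m → Fin r → ℤ) extends TropCurve (n + m) where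
  pos : V → Fin r → ℝ
  dir : G.Dart → Fin r → ℤ
  pos_snd : ∀ (d : G.Dart) (k : Fin r),
    pos d.snd k = pos d.fst k + len ⟨d.edge, d.edge_mem⟩ * (dir d k : ℝ)
  balanced : ∀ v : V,
    ∑ d : G.Dart with d.fst = v, dir d + ∑ i : Fin (n + m) with endVertex i = v, endDir Δ i = 0

namespace LabeledCurve

variable {n r m : ℕ} {Δ : Fin m → Fin r → ℤ}

/-- An isomorphism of labeled curves: an isomorphism of the underlying abstract curves that is
compatible with the maps to `ℝ^r`. -/
structure Iso (C C' : LabeledCurve n r Δ) extends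
    TropCurve.Iso C.toTropCurve C'.toTropCurve where
  pos_map : ∀ v, C'.pos (graphIso v) = C.pos v

end LabeledCurve

/-- The space of labeled `n`-marked tropical curves of degree `Δ` in `ℝ^r`, up to isomorphism. -/
def MLab (n r : ℕ) {m : ℕ} (Δ : Fin m → Fin r → ℤ) : Type 1 :=
  Quot fun C C' : LabeledCurve n r Δ => Nonempty (LabeledCurve.Iso C C')

section Maps

variable {n r m : ℕ} {Δ : Fin m → Fin r → ℤ}

/-- The map `ψ` that forgets the map to `ℝ^r` but keeps all ends. -/
def forget : MLab n r Δ → M0 (n + m) :=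
  Quot.map LabeledCurve.toTropCurve fun _ _ ⟨φ⟩ => ⟨φ.toIso⟩

/-- The evaluation map `ev_i`: the image point `h(x_i)` of the contracted end `x_i`. -/
def ev (i : Fin n) : MLab n r Δ → Fin r → ℝ :=
  Quot.lift (fun C => C.pos (C.endVertex (Fin.castAdd m i))) fun C C' ⟨φ⟩ => by
    rw [φ.endVertex_map, φ.pos_map]

/-- The embedding `C ↦ (φ_N(ψ(C)), ev_1(C))` of the space of labeled curves in `Q_N × ℝ^r`. -/
def embed (hn : 0 < n) (C : MLab n r Δ) : Q (n + m) × (Fin r → ℝ) :=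
  (phi (n + m) (forget C), ev ⟨0, hn⟩ C)

end Maps

/-- The fan structure on the space of labeled curves: the fan `M_{0,N,trop} × ℝ^r` in
`Q_N × ℝ^r` with lattice `Λ_N × ℤ^r`. -/
def labFan (N r : ℕ) (hN : 3 ≤ N) : Fan ((lattice N).prod (stdLattice r)) :=
  (moduliFan N hN).prod (realFan r)

end TropModuli

end

noncomputable section

namespace TropModuli

open Classical

/-! ## The linear map inducing the evaluation maps -/

section EvaluationMap

variable {N r : ℕ}

/-! Removing an oriented bounded edge `d` cuts the tree into two components. Summing the balancing
condition over the vertices of the far component, all edges inside it cancel in pairs, and what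
remains is that the direction of `d` equals the sum of the `v_k` over the ends behind `d`
(`dir_eq_sum_endsBehind`). Since all the `v_k` sum to zero, this is half the signed sum of all
`v_k`, with sign `+` behind `d` and `-` elsewhere (`half_signed_sum`).

The same signs occur in the distances: crossing `d` changes the distance to an end by exactly the
length of `d`, down if the end lies behind `d` and up otherwise (`dist_fst_sub_dist_snd`). Length
times direction is therefore `½ ∑ (dist(fst, x_k) - dist(snd, x_k)) v_k`, an expression that
telescopes along walks (`pos_sub_pos`). Between the vertices carrying `x_1` and `x_i` it gives the
asserted formula; the labels `1` and `i` may be omitted because `v_1 = v_i = 0`.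

The formula descends to `Q_N` because it kills the image of `Φ_N`, again by `∑ v_k = 0`. It is
integral because on `v_I` it takes the value `0` or `±∑_{k ∈ I} v_k` (`distDiff_sepVec_mem`).
Finally, the distance vector of a curve is the combination of its split vectors with the edge
lengths as coefficients (`distVec_eq_sum_sepVec`), so every curve gives a point of the support of
the fan. -/

theorem coord_add (a b : Pairs N → ℝ) (i j : Fin N) :
    coord (a + b) i j = coord a i j + coord b i j := by
  unfold coord
  split_ifs <;> simp

theorem coord_smul (c : ℝ) (a : Pairs N → ℝ) (i j : Fin N) :
    coord (c • a) i j = c * coord a i j := by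
  unfold coord
  split_ifs <;> simp

theorem coord_Phi (a : Fin N → ℝ) {i j : Fin N} (h : i ≠ j) :
    coord (Phi N a) i j = a i + a j := by
  simp [coord, h, Phi]

theorem coord_sepVec (I : Finset (Fin N)) {i j : Fin N} (h : i ≠ j) :
    coord (sepVec I) i j = if (i ∈ I ↔ j ∈ I) then 0 else 1 := by
  by_cases hi : i ∈ I <;> by_cases hj : j ∈ I <;> simp [coord, h, sepVec, hi, hj]

theorem coord_distVec (C : TropCurve N) {i j : Fin N} (h : i ≠ j) :
    coord C.distVec i j = C.dist (C.endVertex i) (C.endVertex j) := by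
  simp [coord, h, TropCurve.distVec]

/-- The linear map `a ↦ ½ ∑_{k ≠ i, j} (a_{i,k} - a_{j,k}) v_k`. -/
def distDiff (v : Fin N → Fin r → ℤ) (i j : Fin N) : (Pairs N → ℝ) →ₗ[ℝ] (Fin r → ℝ) where
  toFun a l := (1 / 2 : ℝ) * ∑ k : Fin N with k ≠ i ∧ k ≠ j,
    (coord a i k - coord a j k) * (v k l : ℝ)
  map_add' a b := by
    ext l
    rw [Pi.add_apply, ← mul_add, ← Finset.sum_add_distrib]
    simp only [coord_add]
    congr 1
    refine Finset.sum_congr rfl fun k _ => ?_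
    ring
  map_smul' c a := by
    ext l
    simp only [Pi.smul_apply, smul_eq_mul, RingHom.id_apply, coord_smul, Finset.mul_sum]
    refine Finset.sum_congr rfl fun k _ => ?_
    ring

theorem distDiff_apply (v : Fin N → Fin r → ℤ) (i j : Fin N) (a : Pairs N → ℝ) (l : Fin r) :
    distDiff v i j a l = (1 / 2 : ℝ) * ∑ k : Fin N with k ≠ i ∧ k ≠ j,
      (coord a i k - coord a j k) * (v k l : ℝ) := rfl

variable {v : Fin N → Fin r → ℤ} {i j : Fin N}

/-- If `v_i = v_j = 0`, the sum in `distDiff` may be taken over all labels. -/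
theorem distDiff_eq_sum (hi : v i = 0) (hj : v j = 0) (a : Pairs N → ℝ) (l : Fin r)
    (g : Fin N → ℝ) (hg : ∀ k, k ≠ i → k ≠ j → coord a i k - coord a j k = g k) :
    distDiff v i j a l = (1 / 2 : ℝ) * ∑ k, g k * (v k l : ℝ) := by
  rw [distDiff_apply, Finset.sum_filter]
  congr 1
  refine Finset.sum_congr rfl fun k _ => ?_
  by_cases h1 : k = i
  · simp [h1, hi]
  by_cases h2 : k = j
  · simp [h2, hj]
  rw [if_pos ⟨h1, h2⟩, hg k h1 h2]

/-! ### Descent to the quotient and integrality on the lattice -/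

theorem sum_cast_eq_zero (hv : ∑ k, v k = 0) (l : Fin r) : ∑ k, (v k l : ℝ) = 0 := by
  have := congrFun hv l
  rw [Finset.sum_apply] at this
  exact_mod_cast this

/-- For `k ≠ i, j` the difference `(a_i + a_k) - (a_j + a_k)` does not depend on `k`, so the sum is
a multiple of `∑ v_k`. -/
theorem range_Phi_le_ker_distDiff (hi : v i = 0) (hj : v j = 0) (hv : ∑ k, v k = 0) :
    LinearMap.range (Phi N) ≤ LinearMap.ker (distDiff v i j) := by
  rintro _ ⟨a, rfl⟩
  rw [LinearMap.mem_ker]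
  ext l
  rw [distDiff_eq_sum hi hj _ l (fun _ => a i - a j) fun k h1 h2 => by
    rw [coord_Phi a h1.symm, coord_Phi a h2.symm]; ring]
  rw [← Finset.mul_sum, sum_cast_eq_zero hv]
  simp

/-- A vector sum weighted by `1` on `I` and `-1` off `I` is twice the sum over `I`, provided that
the total sum vanishes. -/
theorem half_signed_sum (hv : ∑ k, v k = 0) (I : Finset (Fin N)) (l : Fin r) :
    (1 / 2 : ℝ) * ∑ k, (if k ∈ I then (1 : ℝ) else -1) * (v k l : ℝ) = ((∑ k ∈ I, v k) l : ℤ) := by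
  -- The sign is twice the indicator function of `I` minus one; the constant part contributes `∑ v_k
  -- = 0`.
  have h : ∀ k, (if k ∈ I then (1 : ℝ) else -1) * (v k l : ℝ)
      = 2 * (if k ∈ I then (v k l : ℝ) else 0) - v k l := by
    intro k
    split_ifs <;> ring
  simp only [h]
  rw [Finset.sum_sub_distrib, sum_cast_eq_zero hv, ← Finset.mul_sum, Finset.sum_ite_mem]
  simp [Finset.sum_apply]

/-- If `I` does not separate `i` from `j`, all coordinate differences vanish. If it does, they are
all `±1` with the sign depending only on whether `k ∈ I`, and `half_signed_sum` absorbs the factor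
`½`. -/
theorem distDiff_sepVec_mem (hi : v i = 0) (hj : v j = 0) (hv : ∑ k, v k = 0)
    (I : Finset (Fin N)) : distDiff v i j (sepVec I) ∈ stdLattice r := by
  have hmem : ∀ w : Fin r → ℤ, (fun l => (w l : ℝ)) ∈ stdLattice r := fun w => ⟨w, rfl⟩
  by_cases h1 : i ∈ I <;> by_cases h2 : j ∈ I
  · convert (stdLattice r).zero_mem using 1
    ext l
    rw [distDiff_eq_sum hi hj _ l (fun _ => 0) fun k hk hk' => by
      rw [coord_sepVec I hk.symm, coord_sepVec I hk'.symm]; simp [h1, h2]]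
    simp
  · have hneg := neg_mem (hmem (∑ k ∈ I, v k))
    convert hneg using 1
    ext l
    -- Here `i ∈ I` and `j ∉ I`: for `k ∈ I` only `j` is separated from `k`, for `k ∉ I` only `i`
    -- is.
    rw [distDiff_eq_sum hi hj _ l (fun k => -(if k ∈ I then (1 : ℝ) else -1)) fun k hk hk' => by
      rw [coord_sepVec I hk.symm, coord_sepVec I hk'.symm]
      by_cases hkI : k ∈ I <;> simp [h1, h2, hkI]]
    simp only [neg_mul, Finset.sum_neg_distrib, mul_neg, half_signed_sum hv, Pi.neg_apply]
  · convert hmem (∑ k ∈ I, v k) using 1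
    ext l
    rw [distDiff_eq_sum hi hj _ l (fun k => (if k ∈ I then (1 : ℝ) else -1)) fun k hk hk' => by
      rw [coord_sepVec I hk.symm, coord_sepVec I hk'.symm]
      by_cases hkI : k ∈ I <;> simp [h1, h2, hkI]]
    exact half_signed_sum hv I l
  · convert (stdLattice r).zero_mem using 1
    ext l
    rw [distDiff_eq_sum hi hj _ l (fun _ => 0) fun k hk hk' => by
      rw [coord_sepVec I hk.symm, coord_sepVec I hk'.symm]; simp [h1, h2]]
    simp

/-- The map `(q_N(a), b) ↦ b + ½ ∑_{k ≠ i, j} (a_{i,k} - a_{j,k}) v_k`. -/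
def evLinear (hi : v i = 0) (hj : v j = 0) (hv : ∑ k, v k = 0) :
    Q N × (Fin r → ℝ) →ₗ[ℝ] (Fin r → ℝ) :=
  ((LinearMap.range (Phi N)).liftQ (distDiff v i j) (range_Phi_le_ker_distDiff hi hj hv)).coprod
    LinearMap.id

theorem evLinear_apply (hi : v i = 0) (hj : v j = 0) (hv : ∑ k, v k = 0) (a : Pairs N → ℝ)
    (b : Fin r → ℝ) : evLinear hi hj hv (qmap N a, b) = b + distDiff v i j a := by
  rw [add_comm]
  rfl

theorem evLinear_mem_stdLattice (hi : v i = 0) (hj : v j = 0) (hv : ∑ k, v k = 0)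
    {x : Q N × (Fin r → ℝ)} (hx : x ∈ (lattice N).prod (stdLattice r)) :
    evLinear hi hj hv x ∈ stdLattice r := by
  obtain ⟨q, b⟩ := x
  obtain ⟨hq, hb⟩ := AddSubgroup.mem_prod.1 hx
  -- On the second factor the map is the identity, so integrality needs checking only at `b = 0`,
  -- and there only on the generators `v_I`.
  have h0 : ∀ q ∈ lattice N, evLinear hi hj hv (q, 0) ∈ stdLattice r := by
    intro q hq
    induction hq using AddSubgroup.closure_induction with
    | mem q h =>
      obtain ⟨I, -, -, rfl⟩ := h
      rw [splitVec, evLinear_apply, zero_add]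
      exact distDiff_sepVec_mem hi hj hv I
    | zero => exact (map_zero (evLinear hi hj hv)).symm ▸ zero_mem _
    | add p q _ _ hp hq =>
      have : ((p + q, 0) : Q N × (Fin r → ℝ)) = (p, 0) + (q, 0) := by simp
      rw [this, map_add]
      exact add_mem hp hq
    | neg q _ hq =>
      have : ((-q, 0) : Q N × (Fin r → ℝ)) = -(q, 0) := by simp
      rw [this, map_neg]
      exact neg_mem hq
  have hsplit : evLinear hi hj hv (q, b) = evLinear hi hj hv (q, 0) + b := by
    simp [evLinear]
  rw [hsplit]
  exact add_mem (h0 q hq) hb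

end EvaluationMap

/-! ## Distances in a tropical curve -/

section Distances

variable {N : ℕ} (C : TropCurve N)

theorem onPath_edge (d : C.G.Dart) : C.OnPath d.edge d.fst d.snd :=
  ⟨.cons d.adj .nil, by simp [d.adj.ne], by simp [SimpleGraph.Dart.edge]⟩

/-- Adjacent vertices stay in the same component after deletion of any edge other than the one
joining them. -/
theorem onPath_congr_of_ne {e : Sym2 C.V} {u v : C.V} (h : C.G.Adj u v) (he : s(u, v) ≠ e)
    (w : C.V) : C.OnPath e u w ↔ C.OnPath e v w := by
  have hadj : (C.G.deleteEdges {e}).Adj u v := by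
    rw [SimpleGraph.deleteEdges_adj]
    exact ⟨h, he⟩
  rw [onPath_iff, onPath_iff]
  exact not_congr ⟨hadj.reachable.symm.trans, hadj.reachable.trans⟩

/-- Deleting an edge of a tree leaves exactly two components, one for each endpoint of the edge. -/
theorem onPath_snd_iff (d : C.G.Dart) (w : C.V) :
    C.OnPath d.edge d.snd w ↔ ¬ C.OnPath d.edge d.fst w := by
  have h := onPath_edge C d
  have hr := reachable_endpoint C d.fst d.snd w
  rw [onPath_iff] at h ⊢
  rw [onPath_iff, not_not]
  constructor
  · intro hw
    exact (hr.resolve_right fun h' => hw h'.symm).symm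
  · intro hw hw'
    exact h (hw.trans hw'.symm)

/-- The paths to `w` from the two endpoints of `d` differ only in the edge of `d` itself, which lies
on exactly one of them. -/
theorem dist_fst_sub_dist_snd (d : C.G.Dart) (w : C.V) :
    C.dist d.fst w - C.dist d.snd w
      = C.len ⟨d.edge, d.edge_mem⟩ * if C.OnPath d.edge d.fst w then 1 else -1 := by
  unfold TropCurve.dist
  rw [← Finset.sum_sub_distrib, Finset.sum_eq_single ⟨d.edge, d.edge_mem⟩]
  · have h := onPath_snd_iff C d w
    by_cases hw : C.OnPath d.edge d.fst w
    · simp [hw, h]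
    · simp [hw, h]
  · rintro ⟨e, he⟩ - hne
    have hne' : s(d.fst, d.snd) ≠ e := fun h => hne (Subtype.ext h.symm)
    simp [onPath_congr_of_ne C d.adj hne' w]
  · simp

/-! ### Distance vectors as points of the cones of the fan -/

theorem exists_dart (e : C.G.edgeSet) : ∃ d : C.G.Dart, d.edge = e := by
  obtain ⟨e, he⟩ := e
  induction e with
  | _ u v => exact ⟨⟨(u, v), he⟩, rfl⟩

/-- A path uses an edge exactly when its endpoints lie in different components of the complement of
that edge. -/
theorem sepVec_endsBehind (d : C.G.Dart) {i j : Fin N} (h : i ≠ j) :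
    sepVec (C.endsBehind d) ⟨s(i, j), by simpa using h⟩
      = if C.OnPath d.edge (C.endVertex i) (C.endVertex j) then 1 else 0 := by
  have hij : C.OnPath d.edge (C.endVertex i) (C.endVertex j) ↔
      ¬ (C.OnPath d.edge d.fst (C.endVertex i) ↔ C.OnPath d.edge d.fst (C.endVertex j)) := by
    have hr := reachable_endpoint C d.fst d.snd
    have hd : s(d.fst, d.snd) = d.edge := rfl
    have hi := hr (C.endVertex i)
    have hj := hr (C.endVertex j)
    simp only [onPath_iff, hd, not_iff_not] at hi hj ⊢
    constructor
    · intro h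
      exact ⟨fun x => x.trans h, fun x => x.trans h.symm⟩
    · intro h
      by_cases hc : (C.G.deleteEdges {d.edge}).Reachable d.fst (C.endVertex i)
      · exact hc.symm.trans (h.1 hc)
      · have h1 := hi.resolve_left fun x => hc x.symm
        have h2 := hj.resolve_left fun x => hc (h.2 x.symm)
        exact h1.trans h2.symm
  have := coord_sepVec (C.endsBehind d) h
  simp only [coord, h, dite_false, TropCurve.endsBehind, Finset.mem_filter, Finset.mem_univ,
    true_and] at this
  rw [TropCurve.endsBehind, this]
  by_cases hc : C.OnPath d.edge (C.endVertex i) (C.endVertex j)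
  · rw [if_pos hc, if_neg (hij.1 hc)]
  · rw [if_neg hc, if_pos (not_not.1 fun h => hc (hij.2 h))]

/-- The choice `D` of orientations is arbitrary: reversing an edge replaces the set of ends behind
it by its complement, which has the same split vector. -/
theorem distVec_eq_sum_sepVec (D : C.G.edgeSet → C.G.Dart) (hD : ∀ e, (D e).edge = e) :
    C.distVec = ∑ e, C.len e • sepVec (C.endsBehind (D e)) := by
  ext ⟨p, hp⟩
  induction p with
  | _ i j =>
    have hij : i ≠ j := by simpa using hp
    simp only [Finset.sum_apply, Pi.smul_apply, smul_eq_mul]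
    refine Finset.sum_congr rfl fun e _ => ?_
    rw [sepVec_endsBehind C (D e) hij, hD]
    simp

theorem qmap_distVec_mem_curveCone : qmap N C.distVec ∈ curveCone C Set.univ := by
  choose D hD using exists_dart C
  rw [distVec_eq_sum_sepVec C D hD, map_sum]
  refine Submodule.sum_mem _ fun e _ => ?_
  rw [map_smul]
  exact PointedCone.smul_mem _ (C.len_pos e).le
    (Submodule.subset_span ⟨D e, Set.mem_univ _, rfl⟩)

theorem phi_mem_moduliFan_support (hN : 3 ≤ N) (x : M0 N) :
    phi N x ∈ (moduliFan N hN).support := by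
  induction x using Quot.ind with
  | _ C => exact ⟨curveCone C Set.univ, ⟨C, Set.univ, rfl⟩, qmap_distVec_mem_curveCone C⟩

end Distances

/-! ## Directions and positions in a labeled curve -/

section Labeled

variable {n r m : ℕ} {Δ : Fin m → Fin r → ℤ}

theorem endDir_castAdd (i : Fin n) : endDir Δ (Fin.castAdd m i) = 0 := by
  simp [endDir]

theorem sum_endDir (hΔ : ∑ k, Δ k = 0) : ∑ k, endDir (n := n) Δ k = 0 := by
  simp [Fin.sum_univ_add, endDir, hΔ]

theorem realFan_support (x : Fin r → ℝ) : x ∈ (realFan r).support :=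
  ⟨⊤, rfl, trivial⟩

theorem embed_mem_labFan_support (hn : 0 < n) (hN : 3 ≤ n + m) (C : MLab n r Δ) :
    embed hn C ∈ (labFan (n + m) r hN).support := by
  obtain ⟨σ, hσ, h⟩ := phi_mem_moduliFan_support hN (forget C)
  exact ⟨_, ⟨σ, hσ, ⊤, rfl, rfl⟩, h, trivial⟩

namespace LabeledCurve

variable (C : LabeledCurve n r Δ)

/-- Antisymmetry is not part of the structure. It follows by adding `pos_snd` for `d` and for its
reversal and dividing by the positive length. -/
theorem dir_symm (d : C.G.Dart) : C.dir d.symm = -C.dir d := by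
  ext k
  have h1 := C.pos_snd d k
  have h2 := C.pos_snd d.symm k
  have he : (⟨d.symm.edge, d.symm.edge_mem⟩ : C.G.edgeSet) = ⟨d.edge, d.edge_mem⟩ :=
    Subtype.ext d.edge_symm
  rw [he] at h2
  have hl := C.len_pos ⟨d.edge, d.edge_mem⟩
  have h3 : C.len ⟨d.edge, d.edge_mem⟩ * ((C.dir d k : ℝ) + C.dir d.symm k) = 0 := by
    have hf : d.symm.fst = d.snd := rfl
    have hs : d.symm.snd = d.fst := rfl
    rw [hf, hs] at h2
    linarith
  have h4 := (mul_eq_zero.1 h3).resolve_left hl.ne'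
  have h5 : C.dir d k + C.dir d.symm k = 0 := by exact_mod_cast h4
  simp only [Pi.neg_apply]
  omega

/-- By balancing, the direction of an oriented bounded edge is the sum of the directions of all
ends behind it. -/
theorem dir_eq_sum_endsBehind (d : C.G.Dart) :
    C.dir d = ∑ i ∈ C.endsBehind d, endDir Δ i := by
  -- `B` is the vertex set of the far component; the balancing conditions are summed over it.
  set B : Finset C.V := Finset.univ.filter fun w => C.OnPath d.edge d.fst w with hB
  have hmemB : ∀ w, w ∈ B ↔ C.OnPath d.edge d.fst w := by simp [hB]
  have hfst : d.fst ∉ B := by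
    rw [hmemB, onPath_iff, not_not]
  have hsnd : d.snd ∈ B := (hmemB _).2 (onPath_edge C.toTropCurve d)
  have hbal := Finset.sum_eq_zero (s := B) fun w _ => C.balanced w
  rw [Finset.sum_add_distrib] at hbal
  have hends : ∑ w ∈ B, ∑ i : Fin (n + m) with C.endVertex i = w, endDir Δ i
      = ∑ i ∈ C.endsBehind d, endDir Δ i := by
    have hmaps : ∀ i ∈ C.endsBehind d, C.endVertex i ∈ B := by
      intro i hi
      rw [hmemB]
      simpa [TropCurve.endsBehind] using hi
    rw [← Finset.sum_fiberwise_of_maps_to hmaps]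
    refine Finset.sum_congr rfl fun w hw => Finset.sum_congr ?_ fun _ _ => rfl
    ext i
    simp only [Finset.mem_filter, Finset.mem_univ, true_and, TropCurve.endsBehind]
    refine ⟨fun h => ⟨?_, h⟩, And.right⟩
    rw [h]
    exact (hmemB w).1 hw
  have hdarts : ∑ w ∈ B, ∑ d' : C.G.Dart with d'.fst = w, C.dir d'
      = ∑ d' : C.G.Dart with d'.fst ∈ B, C.dir d' := by
    rw [← Finset.sum_fiberwise_of_maps_to (s := Finset.univ.filter fun d' : C.G.Dart => d'.fst ∈ B)
      (t := B) (g := fun d' => d'.fst) (fun d' h => (Finset.mem_filter.1 h).2)]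
    refine Finset.sum_congr rfl fun w hw => Finset.sum_congr ?_ fun _ _ => rfl
    ext d'
    simp only [Finset.mem_filter, Finset.mem_univ, true_and]
    exact ⟨fun h => ⟨h ▸ hw, h⟩, And.right⟩
  -- The only edge leaving the far component is that of `d`, and its orientation leaving `B` is
  -- `d.symm`.
  have hcross : (Finset.univ.filter fun d' : C.G.Dart => d'.fst ∈ B ∧ d'.snd ∉ B) = {d.symm} := by
    ext d'
    simp only [Finset.mem_filter, Finset.mem_univ, true_and, Finset.mem_singleton]
    constructor
    · rintro ⟨h1, h2⟩
      have he : d'.edge = d.edge := by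
        by_contra hne
        have := onPath_congr_of_ne C.toTropCurve d'.adj hne d.fst
        rw [hmemB] at h1 h2
        exact h2 (this.1 h1.symm).symm
      rcases SimpleGraph.dart_edge_eq_iff d' d |>.1 he with rfl | h
      · exact absurd h1 hfst
      · exact h
    · rintro rfl
      exact ⟨hsnd, hfst⟩
  -- Reversal is a fixed-point-free involution on the darts inside `B`, and it negates directions.
  have hinner : ∑ d' : C.G.Dart with d'.fst ∈ B ∧ d'.snd ∈ B, C.dir d' = 0 := by
    refine Finset.sum_involution (fun d' _ => d'.symm) ?_ ?_ ?_ ?_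
    · intro d' _
      rw [dir_symm, add_neg_cancel]
    · intro d' _ _
      exact d'.symm_ne
    · intro d' h
      simp only [Finset.mem_filter, Finset.mem_univ, true_and] at h ⊢
      exact ⟨h.2, h.1⟩
    · intro d' _
      exact d'.symm_symm
  -- The summed balancing condition becomes `-dir d + ∑ (ends behind d) = 0`.
  rw [hends, hdarts, ← Finset.sum_filter_add_sum_filter_not _ fun d' : C.G.Dart => d'.snd ∈ B,
    Finset.filter_filter, Finset.filter_filter, hinner, hcross, Finset.sum_singleton, dir_symm,
    zero_add] at hbal
  exact neg_add_eq_zero.1 hbal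

/-- The case of a single edge: the signs turning the sum over the ends behind `d` into a signed sum
over all ends are those of the distance differences, and the length is their common factor. -/
theorem pos_snd_sub_pos_fst (hΔ : ∑ k, Δ k = 0) (d : C.G.Dart) (l : Fin r) :
    C.pos d.snd l - C.pos d.fst l = (1 / 2 : ℝ) * ∑ k,
      (C.dist d.fst (C.endVertex k) - C.dist d.snd (C.endVertex k)) * (endDir Δ k l : ℝ) := by
  rw [C.pos_snd, dir_eq_sum_endsBehind, ← half_signed_sum (sum_endDir hΔ)]
  simp only [dist_fst_sub_dist_snd, mul_assoc, ← Finset.mul_sum]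
  rw [add_sub_cancel_left, mul_left_comm]
  simp [TropCurve.endsBehind]

/-- The difference of the images of two vertices in terms of their distances to the ends. -/
theorem pos_sub_pos (hΔ : ∑ k, Δ k = 0) (u w : C.V) (l : Fin r) :
    C.pos w l - C.pos u l = (1 / 2 : ℝ) * ∑ k,
      (C.dist u (C.endVertex k) - C.dist w (C.endVertex k)) * (endDir Δ k l : ℝ) := by
  obtain ⟨p⟩ := C.isTree.connected.preconnected u w
  induction p with
  | nil => simp
  | @cons a b c hab p ih =>
    have h := C.pos_snd_sub_pos_fst hΔ ⟨(a, b), hab⟩ l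
    dsimp only at h
    -- Both sides are additive when the walk is split at `b`.
    rw [← sub_add_sub_cancel (C.pos c l) (C.pos b l), ih, h, ← mul_add, ← Finset.sum_add_distrib]
    congr 1
    refine Finset.sum_congr rfl fun k _ => ?_
    ring

end LabeledCurve

theorem evLinear_embed (hn : 0 < n) (hΔ : ∑ k, Δ k = 0) (i : Fin n) (C : MLab n r Δ) :
    evLinear (endDir_castAdd (Δ := Δ) ⟨0, hn⟩) (endDir_castAdd i) (sum_endDir hΔ) (embed hn C)
      = ev i C := by
  induction C using Quot.ind with
  | _ C =>
    change evLinear _ _ _ (qmap (n + m) C.distVec, C.pos (C.endVertex (Fin.castAdd m ⟨0, hn⟩)))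
      = C.pos (C.endVertex (Fin.castAdd m i))
    rw [evLinear_apply]
    ext l
    -- The sum is extended to all labels, with the coordinates replaced by vertex distances, to
    -- match `pos_sub_pos`; the two added terms have direction zero.
    rw [Pi.add_apply, distDiff_eq_sum (endDir_castAdd _) (endDir_castAdd _) _ l _ fun k h1 h2 => by
      rw [coord_distVec _ h1.symm, coord_distVec _ h2.symm]]
    rw [← C.pos_sub_pos hΔ]
    ring

end Labeled

end TropModuli

end

/-! ### The evaluation map as a morphism of fans -/

theorem proposition4p8 (n m r : ℕ) (hn : 0 < n) (hN : 3 ≤ n + m)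
    (Δ : Fin m → Fin r → ℤ) (hΔ : ∀ k, Δ k ≠ 0) (hsum : ∑ k, Δ k = 0) (i : Fin n) :
    ∃ F : TropModuli.Q (n + m) × (Fin r → ℝ) →ₗ[ℝ] (Fin r → ℝ),
      -- `F` is the explicit linear map induced by the one on `ℝ^(N choose 2) × ℝ^r`
      (∀ (a : TropModuli.Pairs (n + m) → ℝ) (b : Fin r → ℝ) (j : Fin r),
        F (TropModuli.qmap (n + m) a, b) j =
          b j + (1 / 2 : ℝ) *
            ∑ k : Fin (n + m) with k ≠ Fin.castAdd m ⟨0, hn⟩ ∧ k ≠ Fin.castAdd m i,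
              (TropModuli.coord a (Fin.castAdd m ⟨0, hn⟩) k
                - TropModuli.coord a (Fin.castAdd m i) k) * (TropModuli.endDir Δ k j : ℝ)) ∧
      -- `F` is integral
      (∀ x ∈ (TropModuli.lattice (n + m)).prod (TropModuli.stdLattice r),
        F x ∈ TropModuli.stdLattice r) ∧
      -- `F` induces `ev_i`
      (∀ C : TropModuli.MLab n r Δ, F (TropModuli.embed hn C) = TropModuli.ev i C) ∧
      -- `ev_i` is a morphism of fans, given by the restriction of `F`
      ∃ f : (TropModuli.labFan (n + m) r hN).support → (TropModuli.realFan r).support,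
        TropModuli.IsFanMorphism (TropModuli.labFan (n + m) r hN) (TropModuli.realFan r) f ∧
        (∀ x, (f x : Fin r → ℝ) = F (x : TropModuli.Q (n + m) × (Fin r → ℝ))) ∧
        ∀ C : TropModuli.MLab n r Δ,
          ∃ hC : TropModuli.embed hn C ∈ (TropModuli.labFan (n + m) r hN).support,
            (f ⟨TropModuli.embed hn C, hC⟩ : Fin r → ℝ) = TropModuli.ev i C := by
  refine ⟨TropModuli.evLinear (TropModuli.endDir_castAdd (Δ := Δ) ⟨0, hn⟩)
    (TropModuli.endDir_castAdd i) (TropModuli.sum_endDir hsum), ?_, ?_,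
    TropModuli.evLinear_embed hn hsum i, ?_⟩
  · intro a b j
    rw [TropModuli.evLinear_apply, Pi.add_apply, TropModuli.distDiff_apply]
  · exact fun x hx => TropModuli.evLinear_mem_stdLattice _ _ _ hx
  -- The support of the target fan is all of `ℝ^r`, so the linear map restricts to the supports
  -- without further conditions.
  · refine ⟨fun x => ⟨_, TropModuli.realFan_support _⟩,
      ⟨_, fun x hx => TropModuli.evLinear_mem_stdLattice _ _ _ hx, fun x => rfl⟩,
      fun x => rfl, fun C => ⟨TropModuli.embed_mem_labFan_support hn hN C, ?_⟩⟩
    exact TropModuli.evLinear_embed hn hsum i C
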